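/- Let $d\ge 1$ be an integer and let $\varepsilon,C_1,C_2>0$ and $M\ge 0$ be real numbers. A dyadic cube in $\mathbb R^d$ is a set $Q=\prod_{i=1}^d[j_i2^k,(j_i+1)2^k)$ with $k,j_1,\dots,j_d\in\mathbb Z$; let $x_Q$ be its center, $\ell(Q)=2^k$ its sidelength and $|Q|$ its Lebesgue measure, and let $\mathcal D_d$ be the set of all dyadic cubes in $\mathbb R^d$. There is a constant $A$, depending only on $\varepsilon,C_1,C_2,M$ and $d$, with the following property. Let $\{f^{(Q)}\}_{Q\in\mathcal D_d}$ be any family of differentiable functions $f^{(Q)}:\mathbb R^d\to\mathbb C$ such that, for every $Q\in\mathcal D_d$, $\int_{\mathbb R^d} f^{(Q)}\,dx=0$ and, for all $x\in\mathbb R^d$, $$|f^{(Q)}(x)|\le C_1(1+|x|)^{-d-\varepsilon}\qquad\text{and}\qquad |\nabla f^{(Q)}(x)|\le C_2(1+|x|)^M .$$ Define $g^{(Q)}(x)=|Q|^{-1/2}f^{(Q)}\big((x-x_Q)/\ell(Q)\big)$. Then for every finite set $S\subset\mathcal D_d$ and all complex numbers $\lambda_Q$ ($Q\in S$), the function $\big|\sum_{Q\in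 S}\lambda_Q g^{(Q)}\big|^2$ is integrable and $$\int_{\mathbb R^d}\Big|\sum_{Q\in S}\lambda_Q\, g^{(Q)}(x)\Big|^2dx\le A\sum_{Q\in S}|\lambda_Q|^2 .$$ -/

import Mathlib

open MeasureTheory

/-- Indices of the dyadic cubes of `ℝᵈ`: the pair `(k, j) ∈ ℤ × ℤᵈ` stands for the cube
`∏ᵢ [jᵢ 2ᵏ, (jᵢ + 1) 2ᵏ)`. -/
structure DyadicCube (d : ℕ) where
  /-- the scale `k` -/
  scale : ℤ
  /-- the position `j` -/
  pos : Fin d → ℤ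

namespace DyadicCube

noncomputable section

variable {d : ℕ}

/-- The sidelength `ℓ(Q) = 2ᵏ`. -/
def sidelength (Q : DyadicCube d) : ℝ := (2 : ℝ) ^ Q.scale

/-- The cube itself, as a subset of `ℝᵈ`. -/
def toSet (Q : DyadicCube d) : Set (EuclideanSpace ℝ (Fin d)) :=
  {x | ∀ i, x i ∈ Set.Ico ((Q.pos i : ℝ) * Q.sidelength) (((Q.pos i : ℝ) + 1) * Q.sidelength)}

/-- The center `x_Q`. -/
def center (Q : DyadicCube d) : EuclideanSpace ℝ (Fin d) :=
  WithLp.toLp 2 fun i => ((Q.pos i : ℝ) + 1 / 2) * Q.sidelength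

/-- The Lebesgue measure `|Q|`. -/
def measure (Q : DyadicCube d) : ℝ := (volume Q.toSet).toReal

theorem sidelength_pos (Q : DyadicCube d) : 0 < Q.sidelength := by
  unfold sidelength; positivity

theorem measure_eq (Q : DyadicCube d) : Q.measure = Q.sidelength ^ d := by
  have h : Q.toSet = (WithLp.ofLp : EuclideanSpace ℝ (Fin d) → Fin d → ℝ) ⁻¹'
      (Set.univ.pi fun i => Set.Ico ((Q.pos i : ℝ) * Q.sidelength)
        (((Q.pos i : ℝ) + 1) * Q.sidelength)) := by
    ext x; simp [toSet]
  have hp := (PiLp.volume_preserving_ofLp (Fin d)).measure_preimage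
    (MeasurableSet.univ_pi (t := fun i => Set.Ico ((Q.pos i : ℝ) * Q.sidelength)
        (((Q.pos i : ℝ) + 1) * Q.sidelength)) fun i => measurableSet_Ico).nullMeasurableSet
  rw [measure, h, hp, volume_pi_pi]
  have e : ∀ i, ((Q.pos i : ℝ) + 1) * Q.sidelength - (Q.pos i : ℝ) * Q.sidelength
      = Q.sidelength := fun i => by ring
  simp [Real.volume_Ico, e, Q.sidelength_pos.le]

/-- In positive dimension distinct indices give distinct cubes. -/
theorem toSet_injective (hd : 0 < d) :
    Function.Injective (toSet : DyadicCube d → Set (EuclideanSpace ℝ (Fin d))) := by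
  intro P Q h
  have hm : P.measure = Q.measure := by rw [measure, measure, h]
  rw [measure_eq, measure_eq] at hm
  have hl : P.sidelength = Q.sidelength :=
    (pow_left_inj₀ P.sidelength_pos.le Q.sidelength_pos.le hd.ne').1 hm
  have hs : P.scale = Q.scale :=
    zpow_right_injective₀ (by norm_num : (0 : ℝ) < 2) (by norm_num) hl
  have key : ∀ R S : DyadicCube d, R.toSet = S.toSet → R.sidelength = S.sidelength →
      ∀ i, S.pos i ≤ R.pos i := by
    intro R S hRS hlen i
    have hR : (WithLp.toLp 2 fun i => (R.pos i : ℝ) * R.sidelength) ∈ R.toSet := by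
      intro i
      have := R.sidelength_pos
      constructor
      · simp
      · simp only; nlinarith
    rw [hRS] at hR
    have := (hR i).1
    rw [← hlen] at this
    exact_mod_cast le_of_mul_le_mul_right this R.sidelength_pos
  have hp : P.pos = Q.pos := funext fun i =>
    le_antisymm (key Q P h.symm hl.symm i) (key P Q h hl i)
  cases P; cases Q; simp_all

end

end DyadicCube

/-- The gradient `∇f(x) = (∂₁f(x), …, ∂_d f(x)) ∈ ℂᵈ` of `f : ℝᵈ → ℂ`, with the Euclidean
norm on `ℂᵈ`. -/
noncomputable def complexGradient {d : ℕ} (f : EuclideanSpace ℝ (Fin d) → ℂ)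
    (x : EuclideanSpace ℝ (Fin d)) : EuclideanSpace ℂ (Fin d) :=
  WithLp.toLp 2 fun i => fderiv ℝ f x (EuclideanSpace.single i (1 : ℝ))

/-- The rescaled function `g(x) = f((x - x_Q) / ℓ(Q)) / |Q|^{1/2}`. -/
noncomputable def vaguelet {d : ℕ} (f : EuclideanSpace ℝ (Fin d) → ℂ) (Q : DyadicCube d)
    (x : EuclideanSpace ℝ (Fin d)) : ℂ :=
  f (Q.sidelength⁻¹ • (x - Q.center)) / ((√Q.measure : ℝ) : ℂ)

/-! The functions at different scales are almost orthogonal, and Schur's test turns this into the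
Bessel bound. Expanding the square leaves the Gram entries `vagueletGram`. For `ℓ(P) ≤ ℓ(Q)`, the
mean zero of the function of `P` allows the value of the function of `Q` at `x_P` to be subtracted.
A Hölder bound of order `θ` then gains `(ℓ(P)/ℓ(Q))^θ`, times an overlap of polynomial bumps
(`vagueletGram_le`).

The gradient may grow, so the Hölder bound with decay comes from interpolation: a small power `θ` of
the gradient bound against the power `1 - θ` of the decay bound leaves decay of some order `s > d`
(`norm_sub_le_of_decay_of_gradient`).

Since `s > d`, bumps sum over the cubes of one scale like integrals. With weights `√|Q|`, the row
sum over scale `m` is at most a constant times `2^(-θ|m-k|)√|P|`, where `k` is the scale of `P`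
(`sum_vagueletGram_mul_le`). Summing the geometric series over `m` gives the hypothesis of
`sum_sum_mul_le_of_schur`. -/

/-- The `L¹`-type bump `x ↦ (1 + |x - y| / L)⁻ˢ` of width `L` around `y`. -/
noncomputable def polyBump {d : ℕ} (s L : ℝ) (y x : EuclideanSpace ℝ (Fin d)) : ℝ :=
  (1 + ‖L⁻¹ • (x - y)‖) ^ (-s)

/-- The integral of the unit bump. -/
noncomputable def bumpMass (d : ℕ) (s : ℝ) : ℝ :=
  ∫ x : EuclideanSpace ℝ (Fin d), (1 + ‖x‖) ^ (-s)

/-! ### Polynomial bumps and their sums over dyadic cubes -/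

section Bumps

variable {d : ℕ} {s L : ℝ}

theorem polyBump_nonneg (s L : ℝ) (y x : EuclideanSpace ℝ (Fin d)) : 0 ≤ polyBump s L y x := by
  unfold polyBump; positivity

theorem polyBump_le_one (hs : 0 ≤ s) (L : ℝ) (y x : EuclideanSpace ℝ (Fin d)) :
    polyBump s L y x ≤ 1 :=
  Real.rpow_le_one_of_one_le_of_nonpos (by linarith [norm_nonneg (L⁻¹ • (x - y))]) (by linarith)

theorem polyBump_comm (s L : ℝ) (y x : EuclideanSpace ℝ (Fin d)) :
    polyBump s L y x = polyBump s L x y := by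
  unfold polyBump; rw [norm_smul, norm_smul, norm_sub_rev]

theorem continuous_polyBump (s L : ℝ) (y : EuclideanSpace ℝ (Fin d)) :
    Continuous (polyBump s L y) := by
  unfold polyBump
  refine Continuous.rpow_const (by fun_prop) fun x => Or.inl ?_
  positivity

theorem bumpMass_nonneg (d : ℕ) (s : ℝ) : 0 ≤ bumpMass d s :=
  integral_nonneg fun x => by positivity

theorem integrable_polyBump (hs : (d : ℝ) < s) (hL : 0 < L) (y : EuclideanSpace ℝ (Fin d)) :
    Integrable (polyBump s L y) := by
  have h : Integrable fun x : EuclideanSpace ℝ (Fin d) => (1 + ‖x‖) ^ (-s) :=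
    integrable_one_add_norm (by simpa using hs)
  exact (h.comp_smul (inv_ne_zero hL.ne')).comp_sub_right y

theorem integral_comp_rescale {F : Type*} [NormedAddCommGroup F] [NormedSpace ℝ F]
    (f : EuclideanSpace ℝ (Fin d) → F) (hL : 0 < L) (y : EuclideanSpace ℝ (Fin d)) :
    ∫ x, f (L⁻¹ • (x - y)) = L ^ d • ∫ x, f x := by
  rw [integral_sub_right_eq_self (fun x => f (L⁻¹ • x)) y, Measure.integral_comp_inv_smul]
  simp [abs_of_pos hL]

theorem integral_polyBump (s : ℝ) (hL : 0 < L) (y : EuclideanSpace ℝ (Fin d)) :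
    ∫ x, polyBump s L y x = L ^ d * bumpMass d s :=
  integral_comp_rescale (fun x : EuclideanSpace ℝ (Fin d) => (1 + ‖x‖) ^ (-s)) hL y

namespace DyadicCube

theorem norm_sub_center_le (Q : DyadicCube d) {x : EuclideanSpace ℝ (Fin d)} (hx : x ∈ Q.toSet) :
    ‖x - Q.center‖ ≤ √d * Q.sidelength := by
  rw [EuclideanSpace.norm_eq]
  have hb : ∀ i, ‖(x - Q.center) i‖ ^ 2 ≤ Q.sidelength ^ 2 := fun i => by
    have := hx i
    have hc : Q.center i = ((Q.pos i : ℝ) + 1 / 2) * Q.sidelength := rfl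
    have hp := Q.sidelength_pos
    rw [PiLp.sub_apply, hc, Real.norm_eq_abs]
    refine pow_le_pow_left₀ (abs_nonneg _) ?_ 2
    rw [abs_le]
    constructor <;> nlinarith [this.1, this.2]
  calc √(∑ i, ‖(x - Q.center) i‖ ^ 2) ≤ √(∑ _i : Fin d, Q.sidelength ^ 2) :=
        Real.sqrt_le_sqrt (Finset.sum_le_sum fun i _ => hb i)
    _ = √d * Q.sidelength := by
        simp [Real.sqrt_sq Q.sidelength_pos.le]

theorem measurableSet_toSet (Q : DyadicCube d) : MeasurableSet Q.toSet := by
  have h : Q.toSet = ⋂ i, (fun x : EuclideanSpace ℝ (Fin d) => x i) ⁻¹'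
      Set.Ico ((Q.pos i : ℝ) * Q.sidelength) (((Q.pos i : ℝ) + 1) * Q.sidelength) := by
    ext x; simp [toSet]
  rw [h]
  exact MeasurableSet.iInter fun i => measurableSet_Ico.preimage (by fun_prop)

theorem disjoint_toSet {P Q : DyadicCube d} (hs : P.scale = Q.scale) (hne : P ≠ Q) :
    Disjoint P.toSet Q.toSet := by
  rw [Set.disjoint_left]
  intro x hP hQ
  apply hne
  have hl : P.sidelength = Q.sidelength := by unfold sidelength; rw [hs]
  have hp := Q.sidelength_pos
  have hpos : P.pos = Q.pos := funext fun i => by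
    have h1 := hP i
    have h2 := hQ i
    rw [hl] at h1
    have a : (P.pos i : ℝ) < Q.pos i + 1 := lt_of_mul_lt_mul_right (h1.1.trans_lt h2.2) hp.le
    have b : (Q.pos i : ℝ) < P.pos i + 1 := lt_of_mul_lt_mul_right (h2.1.trans_lt h1.2) hp.le
    have a' : P.pos i < Q.pos i + 1 := by exact_mod_cast a
    have b' : Q.pos i < P.pos i + 1 := by exact_mod_cast b
    omega
  cases P; cases Q; simp_all

theorem measure_pos (Q : DyadicCube d) : 0 < Q.measure := by
  rw [measure_eq]; exact pow_pos Q.sidelength_pos d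

theorem volume_toSet_ne_top (Q : DyadicCube d) : volume Q.toSet ≠ ⊤ := fun h => by
  have := Q.measure_pos
  rw [measure, h] at this
  simp at this

end DyadicCube

/-- Moving inside `P` shifts the rescaled argument by at most `√d`, so `1 + |·|` grows by a factor
of at most `1 + √d`. -/
theorem polyBump_center_le (hs : 0 ≤ s) (hL : 0 < L) (y : EuclideanSpace ℝ (Fin d))
    (P : DyadicCube d) (hP : P.sidelength ≤ L) {x : EuclideanSpace ℝ (Fin d)}
    (hx : x ∈ P.toSet) :
    polyBump s L y P.center ≤ (1 + √d) ^ s * polyBump s L y x := by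
  have h1 := P.norm_sub_center_le hx
  have h2 : ‖L⁻¹ • (x - y)‖ ≤ ‖L⁻¹ • (P.center - y)‖ + √d := by
    have e : L⁻¹ • (x - y) = L⁻¹ • (P.center - y) + L⁻¹ • (x - P.center) := by
      rw [← smul_add]; congr 1; abel
    rw [e]
    refine (norm_add_le _ _).trans (by
      gcongr
      rw [norm_smul, norm_inv, Real.norm_eq_abs, abs_of_pos hL, inv_mul_le_iff₀ hL, mul_comm]
      exact h1.trans (by gcongr))
  unfold polyBump
  set a := ‖L⁻¹ • (P.center - y)‖
  set b := ‖L⁻¹ • (x - y)‖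
  have ha : 0 ≤ a := norm_nonneg _
  have hb : 0 ≤ b := norm_nonneg _
  have hd := Real.sqrt_nonneg (d : ℝ)
  rw [Real.rpow_neg (by positivity), Real.rpow_neg (by positivity), ← div_eq_mul_inv,
    inv_eq_one_div, div_le_div_iff₀ (by positivity) (by positivity), one_mul,
    ← Real.mul_rpow (by positivity) (by positivity)]
  exact Real.rpow_le_rpow (by positivity) (by nlinarith [mul_nonneg hd ha]) hs

/-- A Riemann sum over cubes of one scale is dominated by the integral. -/
theorem sum_measure_mul_polyBump_le (hs : (d : ℝ) < s) (hL : 0 < L)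
    (y : EuclideanSpace ℝ (Fin d)) (T : Finset (DyadicCube d)) (k : ℤ)
    (hT : ∀ P ∈ T, P.scale = k) (hk : ∀ P ∈ T, P.sidelength ≤ L) :
    ∑ P ∈ T, P.measure * polyBump s L y P.center ≤ (1 + √d) ^ s * bumpMass d s * L ^ d := by
  have hs0 : 0 ≤ s := (Nat.cast_nonneg d).trans hs.le
  have hi := integrable_polyBump hs hL y
  have h1 : ∀ P ∈ T, P.measure * polyBump s L y P.center ≤
      (1 + √d) ^ s * ∫ x in P.toSet, polyBump s L y x := fun P hP => by
    have := setIntegral_mono_on (μ := volume) (s := P.toSet)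
      (f := fun _ => polyBump s L y P.center) (g := fun x => (1 + √d) ^ s * polyBump s L y x)
      (integrableOn_const P.volume_toSet_ne_top) (hi.integrableOn.const_mul _)
      P.measurableSet_toSet fun x hx => polyBump_center_le hs0 hL y P (hk P hP) hx
    rw [setIntegral_const, integral_const_mul] at this
    exact this
  calc _ ≤ ∑ P ∈ T, (1 + √d) ^ s * ∫ x in P.toSet, polyBump s L y x := Finset.sum_le_sum h1
    _ = (1 + √d) ^ s * ∫ x in ⋃ P ∈ T, P.toSet, polyBump s L y x := by
        rw [← Finset.mul_sum, integral_biUnion_finset T (fun P _ => P.measurableSet_toSet)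
          (fun P hP Q hQ hne => DyadicCube.disjoint_toSet ((hT P hP).trans (hT Q hQ).symm) hne)
          (fun P _ => hi.integrableOn)]
    _ ≤ (1 + √d) ^ s * ∫ x, polyBump s L y x := by
        refine mul_le_mul_of_nonneg_left ?_ (by positivity)
        exact setIntegral_le_integral hi (Filter.Eventually.of_forall (polyBump_nonneg s L y))
    _ = _ := by rw [integral_polyBump s hL]; ring

end Bumps

/-! ### Hölder continuity with decay, by interpolation -/

section Smoothness

variable {d : ℕ}

theorem norm_fderiv_le_norm_complexGradient (f : EuclideanSpace ℝ (Fin d) → ℂ)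
    (x : EuclideanSpace ℝ (Fin d)) : ‖fderiv ℝ f x‖ ≤ ‖complexGradient f x‖ := by
  refine ContinuousLinearMap.opNorm_le_bound _ (norm_nonneg _) fun v => ?_
  have e : v = ∑ i, v i • EuclideanSpace.single i (1 : ℝ) := by
    simpa using ((EuclideanSpace.basisFun (Fin d) ℝ).sum_repr v).symm
  calc ‖fderiv ℝ f x v‖ = ‖∑ i, v i • fderiv ℝ f x (EuclideanSpace.single i (1 : ℝ))‖ := by
        conv_lhs => rw [e, map_sum]
        simp only [map_smul]
    _ ≤ ∑ i, ‖complexGradient f x i‖ * ‖v i‖ :=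
        (norm_sum_le _ _).trans (Finset.sum_le_sum fun i _ => by
          rw [norm_smul, mul_comm]; rfl)
    _ ≤ ‖complexGradient f x‖ * ‖v‖ := by
        rw [EuclideanSpace.norm_eq, EuclideanSpace.norm_eq]
        exact Real.sum_mul_le_sqrt_mul_sqrt _ _ _

/-- For `h ≥ 1` the decay bound alone suffices, as `h ^ θ ≥ 1`. For `h < 1` one has `b ≤ 2a`, and
the two bounds are multiplied with exponents `1 - θ` and `θ`; `hps` says that the resulting power of
`a` still decays to order `s`. -/
theorem le_interpolate {C₁ C₂ M p s θ a b h D : ℝ} (hC₁ : 0 < C₁) (hC₂ : 0 < C₂) (hM : 0 ≤ M)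
    (hθ : 0 ≤ θ) (hθ1 : θ ≤ 1) (hps : s ≤ p * (1 - θ) - M * θ) (hp : s ≤ p) (ha : 1 ≤ a)
    (hb : 0 ≤ b) (hh : 0 ≤ h) (hab : b ≤ a + h) (hD : 0 ≤ D)
    (h1 : D ≤ 2 * C₁ * a ^ (-p)) (h2 : D ≤ C₂ * b ^ M * h) :
    D ≤ (2 * C₁ + (2 * C₁) ^ (1 - θ) * (C₂ * 2 ^ M) ^ θ) * h ^ θ * a ^ (-s) := by
  have ha0 : 0 < a := by linarith
  rcases le_or_gt 1 h with hh1 | hh1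
  · have e1 : a ^ (-p) ≤ a ^ (-s) := Real.rpow_le_rpow_of_exponent_le ha (by linarith)
    have e2 : 1 ≤ h ^ θ := Real.one_le_rpow hh1 hθ
    calc D ≤ 2 * C₁ * 1 * a ^ (-s) := by rw [mul_one]; exact h1.trans (by gcongr)
      _ ≤ _ := by
        gcongr
        exact le_add_of_nonneg_right (by positivity)
  · have h3 : D ≤ C₂ * 2 ^ M * a ^ M * h := by
      refine h2.trans ?_
      rw [mul_assoc C₂ (2 ^ M), ← Real.mul_rpow (by norm_num) ha0.le]
      gcongr
      linarith
    have e : D = D ^ (1 - θ) * D ^ θ := by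
      rw [← Real.rpow_add_of_nonneg hD (by linarith) hθ]; simp
    calc D = D ^ (1 - θ) * D ^ θ := e
      _ ≤ (2 * C₁ * a ^ (-p)) ^ (1 - θ) * (C₂ * 2 ^ M * a ^ M * h) ^ θ := by
        gcongr
      _ = (2 * C₁) ^ (1 - θ) * (C₂ * 2 ^ M) ^ θ * h ^ θ * a ^ (-(p * (1 - θ) - M * θ)) := by
        rw [Real.mul_rpow (x := 2 * C₁) (y := a ^ (-p)) (by positivity) (by positivity),
          Real.mul_rpow (y := h) (by positivity) hh,
          Real.mul_rpow (x := C₂ * 2 ^ M) (by positivity) (by positivity), ← Real.rpow_mul ha0.le,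
          ← Real.rpow_mul ha0.le, show -(p * (1 - θ) - M * θ) = -p * (1 - θ) + M * θ by ring,
          Real.rpow_add ha0]
        ring
      _ ≤ _ := by
        gcongr
        exact le_add_of_nonneg_left (by positivity)

/-- Decay and polynomial growth of the gradient interpolate to a Hölder bound with decay. -/
theorem norm_sub_le_of_decay_of_gradient {C₁ C₂ M p s θ : ℝ} (hC₁ : 0 < C₁) (hC₂ : 0 < C₂)
    (hM : 0 ≤ M) (hθ : 0 ≤ θ) (hθ1 : θ ≤ 1) (hps : s ≤ p * (1 - θ) - M * θ) (hp : s ≤ p)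
    (hp0 : 0 ≤ p)
    {f : EuclideanSpace ℝ (Fin d) → ℂ} (hf : Differentiable ℝ f)
    (h1 : ∀ x, ‖f x‖ ≤ C₁ * (1 + ‖x‖) ^ (-p))
    (h2 : ∀ x, ‖complexGradient f x‖ ≤ C₂ * (1 + ‖x‖) ^ M) (x y : EuclideanSpace ℝ (Fin d)) :
    ‖f x - f y‖ ≤ (2 * C₁ + (2 * C₁) ^ (1 - θ) * (C₂ * 2 ^ M) ^ θ) * ‖x - y‖ ^ θ *
      ((1 + ‖x‖) ^ (-s) + (1 + ‖y‖) ^ (-s)) := by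
  wlog hxy : ‖x‖ ≤ ‖y‖ generalizing x y
  · rw [norm_sub_rev, norm_sub_rev x, add_comm ((1 + ‖x‖) ^ (-s))]
    exact this y x (le_of_not_ge hxy)
  have key := le_interpolate (s := s) (p := p) (θ := θ) (a := 1 + ‖x‖) (b := 1 + ‖y‖)
    (h := ‖x - y‖) (D := ‖f x - f y‖) hC₁ hC₂ hM hθ hθ1 hps hp
    (by linarith [norm_nonneg x]) (by positivity) (norm_nonneg _)
    (by have := norm_sub_norm_le y x; rw [norm_sub_rev] at this; linarith) (norm_nonneg _) ?_ ?_
  · exact key.trans (mul_le_mul_of_nonneg_left (le_add_of_nonneg_right (by positivity))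
      (by positivity))
  · have e : (1 + ‖y‖) ^ (-p) ≤ (1 + ‖x‖) ^ (-p) :=
      Real.rpow_le_rpow_of_nonpos (by positivity) (by linarith) (by linarith)
    have := mul_le_mul_of_nonneg_left e hC₁.le
    linarith [norm_sub_le (f x) (f y), h1 x, h1 y]
  -- Mean value inequality on the ball of radius `‖y‖`, which contains both points and on which the
  -- gradient bound is largest at the boundary.
  · refine (convex_closedBall (0 : EuclideanSpace ℝ (Fin d)) ‖y‖).norm_image_sub_le_of_norm_fderiv_le
      (𝕜 := ℝ) (f := f) (fun z _ => hf z) (fun z hz => ?_) (by simp) (by simpa using hxy)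
    refine (norm_fderiv_le_norm_complexGradient f z).trans ((h2 z).trans ?_)
    have : ‖z‖ ≤ ‖y‖ := by simpa using hz
    gcongr

end Smoothness

/-! ### Profiles and their rescalings -/

/-- Continuous functions of mean zero with decay of order `p` and a `θ`-Hölder bound whose
constant decays with order `s`. -/
structure IsVagueletProfile {d : ℕ} (C K p s θ : ℝ) (f : EuclideanSpace ℝ (Fin d) → ℂ) :
    Prop where
  continuous : Continuous f
  integral_eq_zero : ∫ x, f x = 0
  norm_le : ∀ x, ‖f x‖ ≤ C * (1 + ‖x‖) ^ (-p)
  norm_sub_le : ∀ x y, ‖f x - f y‖ ≤ K * ‖x - y‖ ^ θ * ((1 + ‖x‖) ^ (-s) + (1 + ‖y‖) ^ (-s))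

namespace IsVagueletProfile

variable {d : ℕ} {C K p s θ : ℝ} {f g : EuclideanSpace ℝ (Fin d) → ℂ} {P Q : DyadicCube d}

theorem continuous_vaguelet (hf : IsVagueletProfile C K p s θ f) (Q : DyadicCube d) :
    Continuous (vaguelet f Q) := by
  unfold vaguelet
  have := hf.continuous
  fun_prop

theorem integral_vaguelet (hf : IsVagueletProfile C K p s θ f) (Q : DyadicCube d) :
    ∫ x, vaguelet f Q x = 0 := by
  unfold vaguelet
  rw [integral_div, integral_comp_rescale f Q.sidelength_pos, hf.integral_eq_zero]
  simp

theorem norm_vaguelet_le (hf : IsVagueletProfile C K p s θ f) (Q : DyadicCube d)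
    (x : EuclideanSpace ℝ (Fin d)) :
    ‖vaguelet f Q x‖ ≤ C / √Q.measure * polyBump p Q.sidelength Q.center x := by
  unfold vaguelet polyBump
  rw [norm_div, Complex.norm_real, Real.norm_of_nonneg (Real.sqrt_nonneg _), div_mul_eq_mul_div]
  gcongr
  exact hf.norm_le _

theorem norm_vaguelet_sub_le (hf : IsVagueletProfile C K p s θ f) (Q : DyadicCube d)
    (x y : EuclideanSpace ℝ (Fin d)) :
    ‖vaguelet f Q x - vaguelet f Q y‖ ≤ K / √Q.measure * (‖x - y‖ / Q.sidelength) ^ θ *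
      (polyBump s Q.sidelength Q.center x + polyBump s Q.sidelength Q.center y) := by
  have h := hf.norm_sub_le (Q.sidelength⁻¹ • (x - Q.center)) (Q.sidelength⁻¹ • (y - Q.center))
  rw [← smul_sub, sub_sub_sub_cancel_right, norm_smul, norm_inv,
    Real.norm_of_nonneg Q.sidelength_pos.le, inv_mul_eq_div] at h
  unfold vaguelet polyBump
  rw [← sub_div, norm_div, Complex.norm_real, Real.norm_of_nonneg (Real.sqrt_nonneg _),
    div_mul_eq_mul_div, div_mul_eq_mul_div]
  gcongr

theorem integrable_vaguelet (hf : IsVagueletProfile C K p s θ f) (hp : (d : ℝ) < p)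
    (Q : DyadicCube d) : Integrable (vaguelet f Q) :=
  ((integrable_polyBump hp Q.sidelength_pos Q.center).const_mul (C / √Q.measure)).mono'
    (hf.continuous_vaguelet Q).aestronglyMeasurable
    (Filter.Eventually.of_forall (hf.norm_vaguelet_le Q))

theorem integrable_vaguelet_mul_conj (hf : IsVagueletProfile C K p s θ f)
    (hg : IsVagueletProfile C K p s θ g) (hp : (d : ℝ) < p) (hC : 0 ≤ C) (P Q : DyadicCube d) :
    Integrable fun x => vaguelet f P x * starRingEnd ℂ (vaguelet g Q x) := by
  refine (hf.integrable_vaguelet hp P).mul_bdd (c := C / √Q.measure)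
    (Complex.continuous_conj.comp (hg.continuous_vaguelet Q)).aestronglyMeasurable
    (Filter.Eventually.of_forall fun x => ?_)
  rw [RCLike.norm_conj]
  exact (hg.norm_vaguelet_le Q x).trans (mul_le_of_le_one_right (by positivity)
    (polyBump_le_one ((Nat.cast_nonneg d).trans hp.le) _ _ _))

end IsVagueletProfile

/-! ### Almost orthogonality: Gram entries and their row sums -/

section Gram

variable {d : ℕ} {C K p s θ : ℝ} {f g : EuclideanSpace ℝ (Fin d) → ℂ} {P Q : DyadicCube d}

/-- The absolute value of the inner product of two vaguelets. -/
noncomputable def vagueletGram (f : DyadicCube d → EuclideanSpace ℝ (Fin d) → ℂ)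
    (P Q : DyadicCube d) : ℝ :=
  ‖∫ x, vaguelet (f P) P x * starRingEnd ℂ (vaguelet (f Q) Q x)‖

theorem vagueletGram_comm (f : DyadicCube d → EuclideanSpace ℝ (Fin d) → ℂ)
    (P Q : DyadicCube d) : vagueletGram f P Q = vagueletGram f Q P := by
  unfold vagueletGram
  rw [← RCLike.norm_conj, ← integral_conj]
  simp [mul_comm]

/-- The overlap of the bumps of two cubes, which controls their Gram entry. -/
noncomputable def bumpOverlap (s : ℝ) (P Q : DyadicCube d) : ℝ :=
  ∫ x, polyBump s P.sidelength P.center x *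
    (polyBump s Q.sidelength Q.center x + polyBump s Q.sidelength Q.center P.center)

theorem integrable_polyBump_mul (hs : (d : ℝ) < s) (P Q : DyadicCube d) :
    Integrable fun x => polyBump s P.sidelength P.center x * polyBump s Q.sidelength Q.center x := by
  refine (integrable_polyBump hs P.sidelength_pos P.center).mul_bdd (c := 1)
    (continuous_polyBump _ _ _).aestronglyMeasurable (Filter.Eventually.of_forall fun x => ?_)
  rw [Real.norm_of_nonneg (polyBump_nonneg _ _ _ _)]
  exact polyBump_le_one ((Nat.cast_nonneg d).trans hs.le) _ _ _

theorem bumpOverlap_eq (hs : (d : ℝ) < s) (P Q : DyadicCube d) :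
    bumpOverlap s P Q =
      (∫ x, polyBump s P.sidelength P.center x * polyBump s Q.sidelength Q.center x) +
        bumpMass d s * (P.measure * polyBump s Q.sidelength Q.center P.center) := by
  unfold bumpOverlap
  simp only [mul_add]
  rw [integral_add (integrable_polyBump_mul hs P Q)
    ((integrable_polyBump hs P.sidelength_pos P.center).mul_const _), integral_mul_const,
    integral_polyBump s P.sidelength_pos, DyadicCube.measure_eq]
  ring

/-- The Hölder factor is absorbed at the cost of `θ` orders of decay. -/
theorem rpow_mul_polyBump_le {L : ℝ} (hθ : 0 ≤ θ) (hps : s ≤ p - θ)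
    (y x : EuclideanSpace ℝ (Fin d)) :
    ‖L⁻¹ • (x - y)‖ ^ θ * polyBump p L y x ≤ polyBump s L y x := by
  unfold polyBump
  set a := ‖L⁻¹ • (x - y)‖
  have ha : 0 ≤ a := norm_nonneg _
  calc a ^ θ * (1 + a) ^ (-p) ≤ (1 + a) ^ θ * (1 + a) ^ (-p) := by gcongr; linarith
    _ = (1 + a) ^ (θ - p) := by rw [← Real.rpow_add (by positivity)]; ring_nf
    _ ≤ (1 + a) ^ (-s) := Real.rpow_le_rpow_of_exponent_le (by linarith) (by linarith)

/-- Mean zero of the `P` function permits subtracting the constant `vaguelet (f Q) Q P.center`,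
after which the Hölder bound applies. The estimate holds for all pairs but is a gain only when `P`
is the smaller cube. -/
theorem vagueletGram_le {f : DyadicCube d → EuclideanSpace ℝ (Fin d) → ℂ}
    (hf : ∀ Q, IsVagueletProfile C K p s θ (f Q)) (hC : 0 ≤ C) (hK : 0 ≤ K)
    (hs : (d : ℝ) < s) (hθ : 0 ≤ θ) (hps : s ≤ p - θ) (P Q : DyadicCube d) :
    vagueletGram f P Q ≤ C * K / (√P.measure * √Q.measure) *
      (P.sidelength / Q.sidelength) ^ θ * bumpOverlap s P Q := by
  have hp : (d : ℝ) < p := by linarith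
  have hP := P.sidelength_pos
  have hQ := Q.sidelength_pos
  have e : ∫ x, vaguelet (f P) P x * starRingEnd ℂ (vaguelet (f Q) Q x) =
      ∫ x, vaguelet (f P) P x *
        starRingEnd ℂ (vaguelet (f Q) Q x - vaguelet (f Q) Q P.center) := by
    simp only [map_sub, mul_sub]
    rw [integral_sub ((hf P).integrable_vaguelet_mul_conj (hf Q) hp hC P Q)
      (((hf P).integrable_vaguelet hp P).mul_const _), integral_mul_const,
      (hf P).integral_vaguelet, zero_mul, sub_zero]
  unfold vagueletGram bumpOverlap
  rw [e, ← integral_const_mul]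
  refine norm_integral_le_of_norm_le ?_ (Filter.Eventually.of_forall fun x => ?_)
  · refine Integrable.const_mul ?_ _
    simp only [mul_add]
    exact (integrable_polyBump_mul hs P Q).add
      ((integrable_polyBump hs hP P.center).mul_const _)
  · rw [norm_mul, RCLike.norm_conj]
    have e2 : ‖x - P.center‖ / Q.sidelength =
        P.sidelength / Q.sidelength * ‖P.sidelength⁻¹ • (x - P.center)‖ := by
      rw [norm_smul, norm_inv, Real.norm_of_nonneg hP.le]
      field_simp
    have h1 := (hf P).norm_vaguelet_le P x
    have h2 := (hf Q).norm_vaguelet_sub_le Q x P.center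
    rw [e2, Real.mul_rpow (by positivity) (norm_nonneg _)] at h2
    have h3 := rpow_mul_polyBump_le (L := P.sidelength) hθ hps P.center x
    set S := polyBump s Q.sidelength Q.center x + polyBump s Q.sidelength Q.center P.center
    have hS : 0 ≤ S := add_nonneg (polyBump_nonneg _ _ _ _) (polyBump_nonneg _ _ _ _)
    calc _ ≤ _ := mul_le_mul h1 h2 (norm_nonneg _)
          (mul_nonneg (by positivity) (polyBump_nonneg _ _ _ _))
      _ = C * K / (√P.measure * √Q.measure) * (P.sidelength / Q.sidelength) ^ θ *
          ((‖P.sidelength⁻¹ • (x - P.center)‖ ^ θ * polyBump p P.sidelength P.center x) * S) := by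
        field_simp
      _ ≤ _ := by gcongr

variable (d s) in
/-- The bound for the lattice sums of unit bumps. -/
noncomputable def latticeBound : ℝ := (1 + √d) ^ s * bumpMass d s

theorem latticeBound_nonneg : 0 ≤ latticeBound d s :=
  mul_nonneg (by positivity) (bumpMass_nonneg d s)

theorem DyadicCube.sidelength_of_scale {k : ℤ} (h : Q.scale = k) : Q.sidelength = 2 ^ k := by
  rw [DyadicCube.sidelength, h]

/-- By the symmetry of the bump in its two points, this is a Riemann sum of a single bump centred at
`x`. -/
theorem sum_polyBump_le (hs : (d : ℝ) < s) (T : Finset (DyadicCube d)) (k : ℤ)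
    (hT : ∀ P ∈ T, P.scale = k) (x : EuclideanSpace ℝ (Fin d)) :
    ∑ P ∈ T, polyBump s P.sidelength P.center x ≤ latticeBound d s := by
  have h2 : (0 : ℝ) < 2 ^ k := by positivity
  have h := sum_measure_mul_polyBump_le hs h2 x T k hT fun P hP =>
    (DyadicCube.sidelength_of_scale (hT P hP)).le
  have e : ∑ P ∈ T, P.measure * polyBump s (2 ^ k) x P.center =
      (∑ P ∈ T, polyBump s P.sidelength P.center x) * (2 ^ k) ^ d := by
    rw [Finset.sum_mul]
    refine Finset.sum_congr rfl fun P hP => ?_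
    rw [DyadicCube.measure_eq, DyadicCube.sidelength_of_scale (hT P hP), polyBump_comm, mul_comm]
  rw [e] at h
  exact le_of_mul_le_mul_right h (by positivity)

/-- The bumps of the `Q`'s have bounded sum, both at `x` and at `P.center`; integrating against the
bump of `P` leaves `|P|`. -/
theorem sum_bumpOverlap_right_le (hs : (d : ℝ) < s) (P : DyadicCube d)
    (T : Finset (DyadicCube d)) (k : ℤ) (hT : ∀ Q ∈ T, Q.scale = k) :
    ∑ Q ∈ T, bumpOverlap s P Q ≤ 2 * latticeBound d s * bumpMass d s * P.measure := by
  have hi := integrable_polyBump hs P.sidelength_pos P.center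
  unfold bumpOverlap
  rw [← integral_finsetSum _ fun Q _ => by
    simp only [mul_add]
    exact (integrable_polyBump_mul hs P Q).add (hi.mul_const _)]
  calc _ ≤ ∫ x, polyBump s P.sidelength P.center x * (2 * latticeBound d s) := by
        refine integral_mono_of_nonneg (Filter.Eventually.of_forall fun x =>
          Finset.sum_nonneg fun Q _ => mul_nonneg (polyBump_nonneg _ _ _ _)
            (add_nonneg (polyBump_nonneg _ _ _ _) (polyBump_nonneg _ _ _ _)))
          (hi.mul_const _) (Filter.Eventually.of_forall fun x => ?_)
        simp only
        rw [← Finset.mul_sum, Finset.sum_add_distrib]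
        refine mul_le_mul_of_nonneg_left ?_ (polyBump_nonneg _ _ _ _)
        linarith [sum_polyBump_le hs T k hT x, sum_polyBump_le hs T k hT P.center]
    _ = _ := by
        rw [integral_mul_const, integral_polyBump s P.sidelength_pos, DyadicCube.measure_eq]
        ring

/-- Here the bumps of the `P`'s are summed pointwise in the integral. The other term is a Riemann
sum of the bump of `Q` over cubes no larger than `Q`, whence `hk`. -/
theorem sum_bumpOverlap_left_le (hs : (d : ℝ) < s) (Q : DyadicCube d)
    (T : Finset (DyadicCube d)) (k : ℤ) (hT : ∀ P ∈ T, P.scale = k) (hk : k ≤ Q.scale) :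
    ∑ P ∈ T, bumpOverlap s P Q ≤ 2 * latticeBound d s * bumpMass d s * Q.measure := by
  have hi := integrable_polyBump hs Q.sidelength_pos Q.center
  simp only [bumpOverlap_eq hs]
  rw [Finset.sum_add_distrib, ← Finset.mul_sum,
    ← integral_finsetSum _ fun P _ => integrable_polyBump_mul hs P Q]
  have h1 : ∫ x, ∑ P ∈ T, polyBump s P.sidelength P.center x *
      polyBump s Q.sidelength Q.center x ≤ latticeBound d s * (bumpMass d s * Q.measure) := by
    calc _ ≤ ∫ x, latticeBound d s * polyBump s Q.sidelength Q.center x := by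
          refine integral_mono_of_nonneg (Filter.Eventually.of_forall fun x =>
            Finset.sum_nonneg fun P _ => mul_nonneg (polyBump_nonneg _ _ _ _)
              (polyBump_nonneg _ _ _ _)) (hi.const_mul _) (Filter.Eventually.of_forall fun x => ?_)
          simp only
          rw [← Finset.sum_mul]
          exact mul_le_mul_of_nonneg_right (sum_polyBump_le hs T k hT x) (polyBump_nonneg _ _ _ _)
      _ = _ := by
          rw [integral_const_mul, integral_polyBump s Q.sidelength_pos, DyadicCube.measure_eq]
          ring
  have h2 := sum_measure_mul_polyBump_le hs Q.sidelength_pos Q.center T k hT fun P hP => by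
    rw [DyadicCube.sidelength, DyadicCube.sidelength, hT P hP]
    exact zpow_le_zpow_right₀ (by norm_num) hk
  rw [← DyadicCube.measure_eq] at h2
  have h3 := mul_le_mul_of_nonneg_left h2 (bumpMass_nonneg d s)
  unfold latticeBound at h1 ⊢
  linarith

theorem sidelength_div_rpow (θ : ℝ) (h : P.scale ≤ Q.scale) :
    (P.sidelength / Q.sidelength) ^ θ = ((2 : ℝ) ^ (-θ)) ^ (Q.scale - P.scale).natAbs := by
  unfold DyadicCube.sidelength
  rw [← zpow_sub₀ (by norm_num), ← Real.rpow_intCast, ← Real.rpow_natCast,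
    ← Real.rpow_mul (by norm_num), ← Real.rpow_mul (by norm_num)]
  congr 1
  rw [Nat.cast_natAbs, abs_of_nonneg (by omega)]
  push_cast
  ring

/-- Weighted row sums of the Gram matrix over the cubes of one scale. -/
theorem sum_vagueletGram_mul_le {f : DyadicCube d → EuclideanSpace ℝ (Fin d) → ℂ}
    (hf : ∀ Q, IsVagueletProfile C K p s θ (f Q)) (hC : 0 ≤ C) (hK : 0 ≤ K)
    (hs : (d : ℝ) < s) (hθ : 0 ≤ θ) (hps : s ≤ p - θ) (P : DyadicCube d)
    (T : Finset (DyadicCube d)) (m : ℤ) (hT : ∀ Q ∈ T, Q.scale = m) :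
    ∑ Q ∈ T, vagueletGram f P Q * √Q.measure ≤
      C * K * (2 * latticeBound d s * bumpMass d s) * ((2 : ℝ) ^ (-θ)) ^ (m - P.scale).natAbs *
        √P.measure := by
  have hw : ∀ Q : DyadicCube d, 0 < √Q.measure := fun Q => Real.sqrt_pos.2 Q.measure_pos
  have hPm := hw P
  -- `B` is the overlap with the smaller cube first. The weight `√|Q|` cancels one normalization,
  -- and in both cases the overlaps sum to a multiple of `|P|`.
  suffices h : ∃ B : DyadicCube d → ℝ,
      ∑ Q ∈ T, B Q ≤ 2 * latticeBound d s * bumpMass d s * P.measure ∧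
      ∀ Q ∈ T, vagueletGram f P Q * √Q.measure ≤
        C * K / √P.measure * ((2 : ℝ) ^ (-θ)) ^ (m - P.scale).natAbs * B Q by
    obtain ⟨B, hB, h⟩ := h
    calc _ ≤ ∑ Q ∈ T, C * K / √P.measure * ((2 : ℝ) ^ (-θ)) ^ (m - P.scale).natAbs * B Q :=
          Finset.sum_le_sum h
      _ ≤ C * K / √P.measure * ((2 : ℝ) ^ (-θ)) ^ (m - P.scale).natAbs *
          (2 * latticeBound d s * bumpMass d s * P.measure) := by
          rw [← Finset.mul_sum]; gcongr
      _ = _ := by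
          conv_lhs => rw [← Real.mul_self_sqrt P.measure_pos.le]
          field_simp
          rw [Real.sqrt_sq hPm.le]
  rcases le_total P.scale m with hm | hm
  · refine ⟨fun Q => bumpOverlap s P Q, sum_bumpOverlap_right_le hs P T m hT, fun Q hQ => ?_⟩
    have h := vagueletGram_le hf hC hK hs hθ hps P Q
    rw [sidelength_div_rpow θ (by rw [hT Q hQ]; exact hm), hT Q hQ] at h
    have := hw Q
    refine (mul_le_mul_of_nonneg_right h this.le).trans_eq ?_
    field_simp
  · refine ⟨fun Q => bumpOverlap s Q P, sum_bumpOverlap_left_le hs P T m hT hm, fun Q hQ => ?_⟩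
    have h := vagueletGram_le hf hC hK hs hθ hps Q P
    rw [sidelength_div_rpow θ (by rw [hT Q hQ]; exact hm), hT Q hQ,
      show (P.scale - m).natAbs = (m - P.scale).natAbs by omega] at h
    have := hw Q
    rw [vagueletGram_comm]
    refine (mul_le_mul_of_nonneg_right h this.le).trans_eq ?_
    field_simp

theorem summable_pow_natAbs {r : ℝ} (h0 : 0 ≤ r) (h1 : r < 1) :
    Summable fun m : ℤ => r ^ m.natAbs := by
  refine Summable.of_nat_of_neg ?_ ?_ <;> simpa using summable_geometric_of_lt_one h0 h1

theorem sum_pow_natAbs_sub_le {r : ℝ} (h0 : 0 ≤ r) (h1 : r < 1) (F : Finset ℤ) (k : ℤ) :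
    ∑ m ∈ F, r ^ (m - k).natAbs ≤ ∑' m : ℤ, r ^ m.natAbs := by
  have hs := summable_pow_natAbs h0 h1
  have e := (Equiv.subRight k).tsum_eq fun m : ℤ => r ^ m.natAbs
  rw [← e]
  exact ((Equiv.subRight k).summable_iff.2 hs).sum_le_tsum F fun m _ =>
    pow_nonneg h0 _

theorem sum_vagueletGram_mul_le_of_finset {f : DyadicCube d → EuclideanSpace ℝ (Fin d) → ℂ}
    (hf : ∀ Q, IsVagueletProfile C K p s θ (f Q)) (hC : 0 ≤ C) (hK : 0 ≤ K)
    (hs : (d : ℝ) < s) (hθ : 0 < θ) (hps : s ≤ p - θ) (P : DyadicCube d)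
    (S : Finset (DyadicCube d)) :
    ∑ Q ∈ S, vagueletGram f P Q * √Q.measure ≤
      C * K * (2 * latticeBound d s * bumpMass d s) *
        (∑' m : ℤ, ((2 : ℝ) ^ (-θ)) ^ m.natAbs) * √P.measure := by
  classical
  have hN : 0 ≤ latticeBound d s := latticeBound_nonneg
  have hI := bumpMass_nonneg d s
  rw [← Finset.sum_fiberwise_of_maps_to (t := S.image DyadicCube.scale)
    (g := DyadicCube.scale) fun Q hQ => Finset.mem_image_of_mem _ hQ]
  calc _ ≤ ∑ m ∈ S.image DyadicCube.scale, C * K * (2 * latticeBound d s * bumpMass d s) *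
        ((2 : ℝ) ^ (-θ)) ^ (m - P.scale).natAbs * √P.measure :=
        Finset.sum_le_sum fun m _ => sum_vagueletGram_mul_le hf hC hK hs hθ.le hps P _ m
          fun Q hQ => (Finset.mem_filter.1 hQ).2
    _ ≤ _ := by
        rw [← Finset.sum_mul, ← Finset.mul_sum]
        gcongr
        exact sum_pow_natAbs_sub_le (by positivity)
          (Real.rpow_lt_one_of_one_lt_of_neg (by norm_num) (by linarith)) _ _

end Gram

/-! ### Schur's test and the Bessel bound -/

/-- Schur's test for symmetric nonnegative kernels with a positive weight. -/
theorem sum_sum_mul_le_of_schur {ι : Type*} (S : Finset ι) (G : ι → ι → ℝ) (w a : ι → ℝ) {B : ℝ}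
    (hG : ∀ i j, 0 ≤ G i j) (hsymm : ∀ i j, G i j = G j i) (hw : ∀ i, 0 < w i)
    (hB : ∀ i, ∑ j ∈ S, G i j * w j ≤ B * w i) :
    ∑ i ∈ S, ∑ j ∈ S, a i * a j * G i j ≤ B * ∑ i ∈ S, a i ^ 2 := by
  have h1 : ∑ i ∈ S, ∑ j ∈ S, a i ^ 2 / w i * (G i j * w j) ≤ B * ∑ i ∈ S, a i ^ 2 := by
    rw [Finset.mul_sum]
    refine Finset.sum_le_sum fun i _ => ?_
    rw [← Finset.mul_sum]
    refine (mul_le_mul_of_nonneg_left (hB i) (by have := hw i; positivity)).trans_eq ?_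
    have := (hw i).ne'
    field_simp
  have h2 : ∑ i ∈ S, ∑ j ∈ S, a j ^ 2 / w j * (G i j * w i) =
      ∑ i ∈ S, ∑ j ∈ S, a i ^ 2 / w i * (G i j * w j) := by
    rw [Finset.sum_comm]
    refine Finset.sum_congr rfl fun i _ => Finset.sum_congr rfl fun j _ => ?_
    rw [hsymm]
  have h3 : ∑ i ∈ S, ∑ j ∈ S, a i * a j * G i j ≤ ∑ i ∈ S, ∑ j ∈ S,
      (a i ^ 2 / w i * (G i j * w j) + a j ^ 2 / w j * (G i j * w i)) / 2 := by
    refine Finset.sum_le_sum fun i _ => Finset.sum_le_sum fun j _ => ?_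
    have hi := hw i
    have hj := hw j
    -- Weighted AM-GM: the defect is a perfect square over a positive weight.
    have e : (a i ^ 2 / w i * (G i j * w j) + a j ^ 2 / w j * (G i j * w i)) / 2 -
        a i * a j * G i j = G i j * (a i * w j - a j * w i) ^ 2 / (2 * (w i * w j)) := by
      field_simp
      ring
    have : 0 ≤ G i j * (a i * w j - a j * w i) ^ 2 / (2 * (w i * w j)) :=
      div_nonneg (mul_nonneg (hG i j) (sq_nonneg _)) (by positivity)
    linarith
  simp only [← Finset.sum_div, Finset.sum_add_distrib] at h3
  linarith

theorem norm_sum_sq_eq {ι : Type*} (S : Finset ι) (c v : ι → ℂ) :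
    ((‖∑ i ∈ S, c i * v i‖ ^ 2 : ℝ) : ℂ) =
      ∑ i ∈ S, ∑ j ∈ S, c i * starRingEnd ℂ (c j) * (v i * starRingEnd ℂ (v j)) := by
  rw [Complex.ofReal_pow, ← Complex.mul_conj', map_sum, Finset.sum_mul_sum]
  refine Finset.sum_congr rfl fun i _ => Finset.sum_congr rfl fun j _ => ?_
  rw [map_mul]
  ring

/-- Vaguelets with uniform profiles form a Bessel family. -/
theorem integrable_and_integral_vaguelet_sum_le {d : ℕ} {C K p s θ : ℝ}
    {f : DyadicCube d → EuclideanSpace ℝ (Fin d) → ℂ}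
    (hf : ∀ Q, IsVagueletProfile C K p s θ (f Q)) (hC : 0 ≤ C) (hK : 0 ≤ K)
    (hs : (d : ℝ) < s) (hθ : 0 < θ) (hps : s ≤ p - θ) (S : Finset (DyadicCube d))
    (c : DyadicCube d → ℂ) :
    Integrable (fun x => ‖∑ Q ∈ S, c Q * vaguelet (f Q) Q x‖ ^ 2) ∧
      ∫ x, ‖∑ Q ∈ S, c Q * vaguelet (f Q) Q x‖ ^ 2 ≤
        C * K * (2 * latticeBound d s * bumpMass d s) *
          (∑' m : ℤ, ((2 : ℝ) ^ (-θ)) ^ m.natAbs) * ∑ Q ∈ S, ‖c Q‖ ^ 2 := by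
  have hi : ∀ P Q, Integrable fun x => c P * starRingEnd ℂ (c Q) *
      (vaguelet (f P) P x * starRingEnd ℂ (vaguelet (f Q) Q x)) := fun P Q =>
    ((hf P).integrable_vaguelet_mul_conj (hf Q) (by linarith) hC P Q).const_mul _
  have hsum : Integrable fun x => ((‖∑ Q ∈ S, c Q * vaguelet (f Q) Q x‖ ^ 2 : ℝ) : ℂ) := by
    simp only [norm_sum_sq_eq]
    exact integrable_finsetSum _ fun P _ => integrable_finsetSum _ fun Q _ => hi P Q
  refine ⟨hsum.re, ?_⟩
  have e : ((∫ x, ‖∑ Q ∈ S, c Q * vaguelet (f Q) Q x‖ ^ 2 : ℝ) : ℂ) =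
      ∑ P ∈ S, ∑ Q ∈ S, c P * starRingEnd ℂ (c Q) *
        ∫ x, vaguelet (f P) P x * starRingEnd ℂ (vaguelet (f Q) Q x) := by
    rw [← integral_complex_ofReal]
    simp only [norm_sum_sq_eq]
    rw [integral_finsetSum _ fun P _ => integrable_finsetSum _ fun Q _ => hi P Q]
    refine Finset.sum_congr rfl fun P _ => ?_
    rw [integral_finsetSum _ fun Q _ => hi P Q]
    exact Finset.sum_congr rfl fun Q _ => integral_const_mul _ _
  calc _ ≤ ‖((∫ x, ‖∑ Q ∈ S, c Q * vaguelet (f Q) Q x‖ ^ 2 : ℝ) : ℂ)‖ := by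
        rw [Complex.norm_real]; exact Real.le_norm_self _
    _ ≤ ∑ P ∈ S, ∑ Q ∈ S, ‖c P‖ * ‖c Q‖ * vagueletGram f P Q := by
        rw [e]
        refine (norm_sum_le _ _).trans (Finset.sum_le_sum fun P _ => (norm_sum_le _ _).trans
          (Finset.sum_le_sum fun Q _ => ?_))
        rw [norm_mul, norm_mul, RCLike.norm_conj]
        rfl
    _ ≤ _ := sum_sum_mul_le_of_schur S (vagueletGram f) (fun Q => √Q.measure) (fun Q => ‖c Q‖)
        (fun _ _ => norm_nonneg _) (vagueletGram_comm f)
        (fun Q => Real.sqrt_pos.2 Q.measure_pos)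
        fun P => sum_vagueletGram_mul_le_of_finset hf hC hK hs hθ hps P S

theorem corollary1 (d : ℕ) (ε C₁ C₂ M : ℝ) (hε : 0 < ε) (hC₁ : 0 < C₁) (hC₂ : 0 < C₂)
    (hM : 0 ≤ M) :
    ∃ A : ℝ, ∀ f : DyadicCube d → EuclideanSpace ℝ (Fin d) → ℂ,
      (∀ Q, Differentiable ℝ (f Q)) →
      (∀ Q, ∫ x, f Q x = 0) →
      (∀ Q x, ‖f Q x‖ ≤ C₁ * (1 + ‖x‖) ^ (-(d : ℝ) - ε)) →
      (∀ Q x, ‖complexGradient (f Q) x‖ ≤ C₂ * (1 + ‖x‖) ^ M) →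
      ∀ (s : Finset (DyadicCube d)) (c : DyadicCube d → ℂ),
        Integrable (fun x => ‖∑ Q ∈ s, c Q * vaguelet (f Q) Q x‖ ^ 2) ∧
        ∫ x, ‖∑ Q ∈ s, c Q * vaguelet (f Q) Q x‖ ^ 2 ≤ A * ∑ Q ∈ s, ‖c Q‖ ^ 2 := by
  have hd : (0 : ℝ) ≤ d := Nat.cast_nonneg d
  -- With `p = d + ε` and `s = d + ε/2`, this `θ` gives `p(1 - θ) - Mθ = s + θ`; the `+ 1` also
  -- ensures `θ ≤ ε/2`, that is `s ≤ p - θ`.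
  obtain ⟨θ, hθ⟩ : ∃ θ, θ = ε / (2 * (d + ε + M + 1)) := ⟨_, rfl⟩
  have hθ0 : 0 < θ := by rw [hθ]; positivity
  have hmul : θ * (d + ε + M + 1) = ε / 2 := by rw [hθ]; field_simp
  have hθd := mul_nonneg hθ0.le hd
  have hθε := mul_pos hθ0 hε
  have hθM := mul_nonneg hθ0.le hM
  have hθ1 : θ ≤ 1 := by
    rw [hθ, div_le_one (by positivity)]; linarith
  -- `A` is found by unification with the Bessel constant, which does not involve `f`.
  refine ⟨_, fun f hdiff hint hdecay hgrad S c =>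
    integrable_and_integral_vaguelet_sum_le (C := C₁)
      (K := 2 * C₁ + (2 * C₁) ^ (1 - θ) * (C₂ * 2 ^ M) ^ θ) (p := d + ε) (s := d + ε / 2) (θ := θ)
      (fun Q => ?_) hC₁.le (by positivity) (by linarith) hθ0 (by linarith) S c⟩
  have hdec : ∀ x, ‖f Q x‖ ≤ C₁ * (1 + ‖x‖) ^ (-((d : ℝ) + ε)) := fun x => by
    rw [neg_add']; exact hdecay Q x
  exact ⟨(hdiff Q).continuous, hint Q, hdec, norm_sub_le_of_decay_of_gradient hC₁ hC₂ hM hθ0.le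
    hθ1 (by linarith) (by linarith) (by linarith) (hdiff Q) hdec (hgrad Q)⟩
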